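/- A c.p.o. is a partially ordered set with a least element in which every (nonempty) directed subset has a least upper bound; $[D\to E]$ denotes the c.p.o. of Scott-continuous functions with the pointwise order. Let $D_0=\mathbb N^+=\mathbb N\cup\{\bot\}$ be the flat c.p.o. of natural numbers and $D_{n+1}=[D_n\to D_n]$. Define $\varphi_n:D_n\to D_{n+1}$ and $\psi_n:D_{n+1}\to D_n$ by $\varphi_0(d)=(a\mapsto d)$, $\psi_0(g)=g(\bot)$, $\varphi_{n+1}(d)=\varphi_n\circ d\circ\psi_n$, $\psi_{n+1}(g)=\psi_n\circ g\circ\varphi_n$. Let $$D_\infty=\{\langle d_0,d_1,\dots\rangle : d_n\in D_n,\ \psi_n(d_{n+1})=d_n \text{ for all } n\ge 0\},$$ ordered coordinatewise, with the Scott topology. Let $\varphi_{n,\infty}:D_n\to D_\infty$ be the map whose $m$-th coordinate is $\varphi_{m-1}\circ\cdots\circ\varphi_n$ for $m\ge n$ and $\psi_m\circ\cdots\circ\psi_{n-1}$ for $m<n$. Application in $D_\infty$ is $$a\bullet b=\bigsqcup_{n\ge 0}\varphi_{n,\infty}\bigl(a_{n+1}(b_n)\bigr).$$ For a topological space $D$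 and $d\in D$ put $\pi_0(D,d):=d$, and for $n\ge 1$ let $\pi_n(D,d)$ be the $n$-th homotopy group, regarded as the set of homotopy classes (relative to the boundary) of continuous maps $[0,1]^n\to D$ sending the boundary of the cube to $d$, each class being a set of maps; thus $\pi_n(D,d)=\pi_n(D,d')$ if and only if $d=d'$. Let $\mathfrak D_n=\{\pi_n(D_\infty,d):d\in D_\infty\}$, with source and target maps $s(\pi_{n+1}(D_\infty,d))=t(\pi_{n+1}(D_\infty,d))=\pi_n(D_\infty,d)$, and let $\mathfrak D_\infty$ be the set of all sequences $\langle\mathfrak d_0,\mathfrak d_1,\dots\rangle$ with $\mathfrak d_n\in\mathfrak D_n$ and $s(\mathfrak d_{n+1})=t(\mathfrak d_{n+1})=\mathfrak d_n$ for all $n$. Define application on $\mathfrak D_n$ by $\pi_n(D_\infty,a)\bullet\pi_n(D_\infty,b)=\pi_n(D_\infty,a\bullet b)$, and on $\mathfrak D_\infty$ componentwise. A $\lambda$-model is a set $D$ with at least two elements, a binary operation $\bullet$ on $D$, and a map assigning to each type-free $\lambda$-term $M$ and each assignment $\rho$ of elements of $D$ to the variables an element $[\![M]\!]_\rho\in D$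 such that (1) $[\![x]\!]_\rho=\rho(x)$; (2) $[\![PQ]\!]_\rho=[\![P]\!]_\rho\bullet[\![Q]\!]_\rho$; (3) $[\![\lambda x.P]\!]_\rho\bullet d=[\![P]\!]_{[d/x]\rho}$ for all $d\in D$; (4) $[\![M]\!]_\rho=[\![M]\!]_\sigma$ if $\rho,\sigma$ agree on $FV(M)$; (5) $[\![\lambda x.M]\!]_\rho=[\![\lambda y.[y/x]M]\!]_\rho$ if $y\notin FV(M)$; (6) if $[\![P]\!]_{[d/x]\rho}=[\![Q]\!]_{[d/x]\rho}$ for all $d\in D$, then $[\![\lambda x.P]\!]_\rho=[\![\lambda x.Q]\!]_\rho$. A pair $\langle D,\bullet\rangle$ is an extensional $\lambda$-model if some $[\![\ ]\!]$ makes it a $\lambda$-model and, for all $a,b\in D$, $a\bullet d=b\bullet d$ for every $d\in D$ implies $a=b$. **Theorem.** The map $F$, $F(a)=\langle\pi_n(D_\infty,a)\rangle_{n\ge0}$, is a bijection from $D_\infty$ onto $\mathfrak D_\infty$ with $F(a\bullet b)=F(a)\bullet F(b)$ for all $a,b\in D_\infty$; that is, $\langle D_\infty,\bullet\rangle\cong\langle\mathfrak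 D_\infty,\bullet\rangle$. Consequently $\langle\mathfrak D_\infty,\bullet\rangle$ is an extensional $\lambda$-model. -/

import Mathlib

open Set
open scoped unitInterval Topology

universe u v

noncomputable section

namespace ScottModel

/-! ## Complete partial orders and spaces of Scott-continuous functions -/

/-- A partial order in which every directed set (the empty one included) has a least upper bound is
a c.p.o.; `sSup` of a directed set is its least upper bound. -/
@[reducible] def cpoOfExistsLUB (α : Type u) [PartialOrder α]
    (h : ∀ d : Set α, DirectedOn (· ≤ ·) d → ∃ a, IsLUB d a) : CompletePartialOrder α :=
  letI : SupSet α := ⟨fun d =>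
    letI := Classical.propDecidable (DirectedOn (· ≤ ·) d)
    if hd : DirectedOn (· ≤ ·) d then (h d hd).choose
      else (h ∅ IsChain.empty.directedOn).choose⟩
  CompletePartialOrder.ofLubOfDirected α (fun d hd => by
    have e : sSup d = (h d hd).choose :=
      @dif_pos _ (Classical.propDecidable _) hd _ _ _
    rw [e]
    exact (h d hd).choose_spec)

/-- The set `[D → E]` of Scott-continuous functions. -/
@[ext] structure ScottMap (D : Type u) (E : Type v) [Preorder D] [Preorder E] :
    Type (max u v) where
  /-- The underlying function. -/
  toFun : D → E
  scott : ScottContinuous toFun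

section ScottMap

variable {D : Type u} {E : Type v} [CompletePartialOrder D] [CompletePartialOrder E]

/-- The pointwise order on `[D → E]`. -/
instance : PartialOrder (ScottMap D E) :=
  PartialOrder.lift ScottMap.toFun fun _ _ => ScottMap.ext

theorem ScottMap.directedOn_eval {d : Set (ScottMap D E)} (hd : DirectedOn (· ≤ ·) d) (x : D) :
    DirectedOn (· ≤ ·) ((fun f : ScottMap D E => f.toFun x) '' d) := by
  rintro _ ⟨f, hf, rfl⟩ _ ⟨g, hg, rfl⟩
  obtain ⟨k, hk, hfk, hgk⟩ := hd f hf g hg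
  exact ⟨k.toFun x, ⟨k, hk, rfl⟩, hfk x, hgk x⟩

theorem ScottMap.isLUB_of_eval {d : Set (ScottMap D E)} {s : ScottMap D E}
    (h : ∀ x, IsLUB ((fun f : ScottMap D E => f.toFun x) '' d) (s.toFun x)) : IsLUB d s :=
  ⟨fun f hf x => (h x).1 ⟨f, hf, rfl⟩, fun t ht x => (h x).2 (by
    rintro _ ⟨f, hf, rfl⟩
    exact ht hf x)⟩

theorem ScottMap.exists_pointwise_lub (d : Set (ScottMap D E)) (hd : DirectedOn (· ≤ ·) d) :
    ∃ s : ScottMap D E, ∀ x, IsLUB ((fun f : ScottMap D E => f.toFun x) '' d) (s.toFun x) := by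
  have hl : ∀ x, IsLUB ((fun f : ScottMap D E => f.toFun x) '' d)
      (sSup ((fun f : ScottMap D E => f.toFun x) '' d)) :=
    fun x => (ScottMap.directedOn_eval hd x).isLUB_sSup
  refine ⟨⟨fun x => sSup ((fun f : ScottMap D E => f.toFun x) '' d), ?_⟩, hl⟩
  intro X hX hXd a ha
  constructor
  · rintro _ ⟨x, hx, rfl⟩
    refine (hl x).2 ?_
    rintro _ ⟨f, hf, rfl⟩
    exact (f.scott.monotone (ha.1 hx)).trans ((hl a).1 ⟨f, hf, rfl⟩)
  · intro t ht
    refine (hl a).2 ?_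
    rintro _ ⟨f, hf, rfl⟩
    refine (f.scott hX hXd ha).2 ?_
    rintro _ ⟨x, hx, rfl⟩
    exact ((hl x).1 ⟨f, hf, rfl⟩).trans (ht ⟨x, hx, rfl⟩)

/-- `[D → E]` is a c.p.o. -/
instance : CompletePartialOrder (ScottMap D E) :=
  cpoOfExistsLUB _ fun d hd =>
    (ScottMap.exists_pointwise_lub d hd).imp fun _ hs => ScottMap.isLUB_of_eval hs

theorem ScottMap.isLUB_eval {d : Set (ScottMap D E)} (hd : DirectedOn (· ≤ ·) d)
    {s : ScottMap D E} (hs : IsLUB d s) (x : D) :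
    IsLUB ((fun f : ScottMap D E => f.toFun x) '' d) (s.toFun x) := by
  obtain ⟨t, ht⟩ := ScottMap.exists_pointwise_lub d hd
  rw [hs.unique (ScottMap.isLUB_of_eval ht)]
  exact ht x

/-- The map `d ↦ (the constant function with value d)`. -/
def ScottMap.constMap (D : Type u) [CompletePartialOrder D] : ScottMap D (ScottMap D D) :=
  ⟨fun d => ⟨fun _ => d, ScottContinuous.const d⟩, fun X hX _ a ha =>
    ScottMap.isLUB_of_eval fun x => by
      rw [Set.image_image]
      simpa using ha⟩

/-- The map `g ↦ g(⊥)`. -/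
def ScottMap.evalBot (D : Type u) [CompletePartialOrder D] : ScottMap (ScottMap D D) D :=
  ⟨fun g => g.toFun ⊥, fun _ _ hXd _ ha => ScottMap.isLUB_eval hXd ha ⊥⟩

/-- The map `d ↦ p ∘ d ∘ q` from `[D → D]` to `[E → E]`. -/
def ScottMap.conj (p : ScottMap D E) (q : ScottMap E D) :
    ScottMap (ScottMap D D) (ScottMap E E) :=
  ⟨fun d => ⟨p.toFun ∘ d.toFun ∘ q.toFun, (q.scott.comp d.scott).comp p.scott⟩, fun X hX hXd a ha =>
    ScottMap.isLUB_of_eval fun x => by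
      have h := p.scott (hX.image _) (ScottMap.directedOn_eval hXd (q.toFun x))
        (ScottMap.isLUB_eval hXd ha (q.toFun x))
      rw [Set.image_image] at h
      rw [Set.image_image]
      exact h⟩

end ScottMap

/-! ## The flat c.p.o. of natural numbers -/

/-- The set `ℕ⁺ = ℕ ∪ {⊥}`; `none` is `⊥`. -/
def NatPlus : Type := Option ℕ

/-- The flat order: `a ⊑ b` iff `a = ⊥` or `a = b`. -/
instance : PartialOrder NatPlus where
  le a b := a = none ∨ a = b
  le_refl _ := Or.inr rfl
  le_trans a b c := by
    rintro (h | rfl) h'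
    · exact Or.inl h
    · exact h'
  le_antisymm a b := by
    rintro (rfl | h) (h' | h')
    · exact h'.symm
    · exact h'.symm
    · exact h
    · exact h

theorem NatPlus.le_def (a b : NatPlus) : a ≤ b ↔ a = none ∨ a = b := Iff.rfl

instance : CompletePartialOrder NatPlus :=
  cpoOfExistsLUB _ fun d hd => by
    by_cases h : ∃ a ∈ d, a ≠ none
    · obtain ⟨a, ha, hne⟩ := h
      refine ⟨a, fun b hb => ?_, fun t ht => ht ha⟩
      obtain ⟨c, -, hac, hbc⟩ := hd a ha b hb
      rcases hac with h | rfl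
      · exact absurd h hne
      · exact hbc
    · push Not at h
      exact ⟨none, fun b hb => Or.inl (h b hb), fun t _ => Or.inl rfl⟩

/-! ## The c.p.o. `D_∞` -/

/-- `D_0 = ℕ⁺`, `D_{n+1} = [D_n → D_n]`, as types bundled with their c.p.o. structure. -/
def stagePair : ℕ → (α : Type) × CompletePartialOrder α
  | 0 => ⟨NatPlus, inferInstance⟩
  | n + 1 =>
    letI := (stagePair n).2
    ⟨ScottMap (stagePair n).1 (stagePair n).1, inferInstance⟩

/-- The c.p.o. `D_n`. -/
def Stage (n : ℕ) : Type := (stagePair n).1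

instance (n : ℕ) : CompletePartialOrder (Stage n) := (stagePair n).2

/-- An element of `D_{n+1}` as the Scott-continuous function `D_n → D_n` that it is. -/
def Stage.toMap {n : ℕ} (f : Stage (n + 1)) : ScottMap (Stage n) (Stage n) := f

/-- The pairs `(φ_n, ψ_n)`:
`φ_0(d) = (a ↦ d)`, `ψ_0(g) = g(⊥)`, `φ_{n+1}(d) = φ_n ∘ d ∘ ψ_n`, `ψ_{n+1}(g) = ψ_n ∘ g ∘ φ_n`. -/
def projPair : ∀ n : ℕ, ScottMap (Stage n) (Stage (n + 1)) × ScottMap (Stage (n + 1)) (Stage n)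
  | 0 => (ScottMap.constMap (Stage 0), ScottMap.evalBot (Stage 0))
  | n + 1 =>
    (ScottMap.conj (D := Stage n) (E := Stage (n + 1)) (projPair n).1 (projPair n).2,
      ScottMap.conj (D := Stage (n + 1)) (E := Stage n) (projPair n).2 (projPair n).1)

/-- `φ_n : D_n → D_{n+1}`. -/
def phi (n : ℕ) : Stage n → Stage (n + 1) := (projPair n).1.toFun

/-- `ψ_n : D_{n+1} → D_n`. -/
def psi (n : ℕ) : Stage (n + 1) → Stage n := (projPair n).2.toFun

theorem psi_scottContinuous (n : ℕ) : ScottContinuous (psi n) := (projPair n).2.scott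

theorem psi_phi : ∀ (n : ℕ) (d : Stage n), psi n (phi n d) = d
  | 0, _ => rfl
  | n + 1, d => ScottMap.ext (funext fun (x : Stage n) => by
      change psi n (phi n (d.toMap.toFun (psi n (phi n x)))) = d.toMap.toFun x
      rw [psi_phi n, psi_phi n])

/-- `D_∞`: the sequences `⟨d_0, d_1, …⟩` with `d_n ∈ D_n` and `ψ_n(d_{n+1}) = d_n`. -/
@[ext] structure DInf : Type where
  /-- The components `d_n`. -/
  coord : ∀ n, Stage n
  compat : ∀ n, psi n (coord (n + 1)) = coord n

/-- The coordinatewise order on `D_∞`. -/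
instance : PartialOrder DInf :=
  PartialOrder.lift DInf.coord fun _ _ => DInf.ext

theorem DInf.exists_lub (X : Set DInf) (hX : DirectedOn (· ≤ ·) X) : ∃ a, IsLUB X a := by
  rcases X.eq_empty_or_nonempty with rfl | hne
  · have hbot : ∀ n, psi n (⊥ : Stage (n + 1)) = ⊥ := fun n =>
      le_antisymm (((psi_scottContinuous n).monotone bot_le).trans (psi_phi n ⊥).le) bot_le
    exact ⟨⟨fun _ => ⊥, hbot⟩, fun _ h => h.elim, fun t _ n => bot_le⟩
  · have hdir : ∀ n, DirectedOn (· ≤ ·) ((fun d : DInf => d.coord n) '' X) := by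
      rintro n _ ⟨f, hf, rfl⟩ _ ⟨g, hg, rfl⟩
      obtain ⟨k, hk, hfk, hgk⟩ := hX f hf g hg
      exact ⟨k.coord n, ⟨k, hk, rfl⟩, hfk n, hgk n⟩
    have hl := fun n => (hdir n).isLUB_sSup
    refine ⟨⟨fun n => sSup ((fun d : DInf => d.coord n) '' X), fun n => ?_⟩, fun d hd n => ?_,
      fun t ht n => ?_⟩
    · have h := psi_scottContinuous n (hne.image _) (hdir (n + 1)) (hl (n + 1))
      rw [Set.image_image] at h
      refine h.unique ?_
      simp only [DInf.compat]
      exact hl n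
    · exact (hl n).1 ⟨d, hd, rfl⟩
    · refine (hl n).2 ?_
      rintro _ ⟨d, hd, rfl⟩
      exact ht hd n

/-- `D_∞` is a c.p.o. -/
instance : CompletePartialOrder DInf := cpoOfExistsLUB _ DInf.exists_lub

/-- `D_∞` carries the Scott topology: the open sets are the upper sets that are inaccessible by
suprema of nonempty directed sets. -/
instance : TopologicalSpace DInf := Topology.scott DInf Set.univ

/-- `φ_{n,m} : D_n → D_m`: the composite `φ_{m-1} ∘ ⋯ ∘ φ_n` if `n ≤ m`, and the composite
`ψ_m ∘ ⋯ ∘ ψ_{n-1}` if `m < n`. -/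
def phiTo (n m : ℕ) (x : Stage n) : Stage m :=
  if h : n ≤ m then Nat.leRecOn h (fun {k} => phi k) x
  else Nat.decreasingInduction (motive := fun k _ => Stage k) (fun k _ => psi k) x
    (Nat.le_of_not_le h)

theorem psi_phiTo (n m : ℕ) (x : Stage n) : psi m (phiTo n (m + 1) x) = phiTo n m x := by
  unfold phiTo
  by_cases h : n ≤ m
  · rw [dif_pos h, dif_pos (h.trans m.le_succ), Nat.leRecOn_succ h, psi_phi]
  · rw [dif_neg h]
    have hm : m + 1 ≤ n := Nat.lt_of_not_le h
    rcases hm.eq_or_lt with rfl | h'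
    · rw [dif_pos le_rfl, Nat.leRecOn_self, Nat.decreasingInduction_succ']
    · rw [dif_neg (Nat.not_le.2 h'), Nat.decreasingInduction_succ_left _ _ hm]

/-- `φ_{n,∞} : D_n → D_∞`, `φ_{n,∞}(x) = ⟨φ_{n,0}(x), φ_{n,1}(x), …⟩`. -/
def phiInf (n : ℕ) (x : Stage n) : DInf := ⟨fun m => phiTo n m x, fun m => psi_phiTo n m x⟩

/-- Application in `D_∞`: `a • b = ⨆ n, φ_{n,∞}(a_{n+1}(b_n))`. -/
def DInf.app (a b : DInf) : DInf :=
  sSup (Set.range fun n : ℕ => phiInf n ((a.coord (n + 1)).toMap.toFun (b.coord n)))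

/-! ## The ∞-groupoid generated by a topological space -/

section Groupoid

variable (X : Type u) [TopologicalSpace X]

/-- The ambient type in which `π_n(X, x)` lives: points for `n = 0`, and sets of sets of maps
`[0,1]^n → X` for `n ≥ 1`. -/
def CellType : ℕ → Type u
  | 0 => X
  | n + 1 => Set (Set C(I^ Fin (n + 1), X))

variable {X}

/-- `π_n(X, x)`. By convention `π_0(X, x) = x`. For `n ≥ 1` it is the set of homotopy classes
(relative to the boundary) of the maps `[0,1]^n → X` that send the boundary of the cube to `x`,
each class being the set of its members. -/
def piCell : ∀ n : ℕ, X → CellType X n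
  | 0, x => x
  | n + 1, x => Set.range fun q : HomotopyGroup.Pi (n + 1) X x =>
      {p : C(I^ Fin (n + 1), X) | ∃ h : p ∈ GenLoop (Fin (n + 1)) X x,
        (Quotient.mk (GenLoop.Homotopic.setoid (Fin (n + 1)) x) ⟨p, h⟩ :
          HomotopyGroup.Pi (n + 1) X x) = q}

/-- Distinct base points have distinct (not merely non-isomorphic) `π_n`. -/
theorem piCell_injective : ∀ n : ℕ, Function.Injective (piCell n : X → CellType X n)
  | 0 => fun _ _ h => h
  | n + 1 => fun x y hxy => by
      have hmem : {p : C(I^ Fin (n + 1), X) | ∃ h : p ∈ GenLoop (Fin (n + 1)) X x,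
          (Quotient.mk (GenLoop.Homotopic.setoid (Fin (n + 1)) x) ⟨p, h⟩ :
            HomotopyGroup.Pi (n + 1) X x) = Quotient.mk _ GenLoop.const} ∈
          (Set.range fun q : HomotopyGroup.Pi (n + 1) X y =>
            {p : C(I^ Fin (n + 1), X) | ∃ h : p ∈ GenLoop (Fin (n + 1)) X y,
              (Quotient.mk (GenLoop.Homotopic.setoid (Fin (n + 1)) y) ⟨p, h⟩ :
                HomotopyGroup.Pi (n + 1) X y) = q}) := by
        have hr : _ ∈ (show Set (Set C(I^ Fin (n + 1), X)) from piCell (n + 1) x) :=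
          Set.mem_range_self (Quotient.mk (GenLoop.Homotopic.setoid (Fin (n + 1)) x) GenLoop.const)
        rw [hxy] at hr
        exact hr
      obtain ⟨q, hq⟩ := hmem
      have hc : (GenLoop.const : GenLoop (Fin (n + 1)) X x).1 ∈
          {p : C(I^ Fin (n + 1), X) | ∃ h : p ∈ GenLoop (Fin (n + 1)) X x,
          (Quotient.mk (GenLoop.Homotopic.setoid (Fin (n + 1)) x) ⟨p, h⟩ :
            HomotopyGroup.Pi (n + 1) X x) = Quotient.mk _ GenLoop.const} :=
        ⟨GenLoop.const.2, rfl⟩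
      rw [← hq] at hc
      obtain ⟨h, -⟩ := hc
      exact h (fun _ => 0) ⟨0, Or.inl rfl⟩

variable (X)

/-- `𝔇_n = {π_n(X, x) : x ∈ X}`. -/
def Glob (n : ℕ) : Type u := {c : CellType X n // ∃ x : X, piCell n x = c}

variable {X}

/-- `π_n(X, x)` as an element of `𝔇_n`. -/
def Glob.pi (n : ℕ) (x : X) : Glob X n := ⟨piCell n x, x, rfl⟩

/-- A base point of an element of `𝔇_n`; it is unique, by `piCell_injective`. -/
def Glob.base {n : ℕ} (c : Glob X n) : X := c.2.choose

theorem Glob.pi_base {n : ℕ} (c : Glob X n) : Glob.pi n c.base = c :=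
  Subtype.ext c.2.choose_spec

theorem Glob.base_pi (n : ℕ) (x : X) : (Glob.pi n x).base = x :=
  piCell_injective n (Glob.pi n x).2.choose_spec

/-- The source map `s(π_{n+1}(X, x)) = π_n(X, x)`. -/
def Glob.src {n : ℕ} (c : Glob X (n + 1)) : Glob X n := Glob.pi n c.base

/-- The target map `t(π_{n+1}(X, x)) = π_n(X, x)`. -/
def Glob.tgt {n : ℕ} (c : Glob X (n + 1)) : Glob X n := Glob.pi n c.base

variable (X)

/-- `𝔇_∞`: the sequences `⟨𝔡_0, 𝔡_1, …⟩` with `𝔡_n ∈ 𝔇_n` and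
`s(𝔡_{n+1}) = t(𝔡_{n+1}) = 𝔡_n`. -/
def GlobSeq : Type u :=
  {c : ∀ n, Glob X n // ∀ n, (c (n + 1)).src = c n ∧ (c (n + 1)).tgt = c n}

end Groupoid

/-- Application in `𝔇_n`: `π_n(D_∞, a) • π_n(D_∞, b) = π_n(D_∞, a • b)`. -/
def Glob.app {n : ℕ} (c c' : Glob DInf n) : Glob DInf n := Glob.pi n (c.base.app c'.base)

theorem Glob.app_pi (n : ℕ) (a b : DInf) :
    (Glob.pi n a).app (Glob.pi n b) = Glob.pi n (a.app b) := by
  simp only [Glob.app, Glob.base_pi]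

/-- Application in `𝔇_∞` is componentwise. -/
def GlobSeq.app (c c' : GlobSeq DInf) : GlobSeq DInf :=
  ⟨fun n => (c.1 n).app (c'.1 n), fun n => by
    have h : Glob.pi n ((c.1 (n + 1)).app (c'.1 (n + 1))).base = (c.1 n).app (c'.1 n) := by
      rw [← (c.2 n).1, ← (c'.2 n).1]
      simp only [Glob.app, Glob.base_pi, Glob.src]
    exact ⟨h, h⟩⟩

/-! ## λ-terms and (extensional) λ-models -/

/-- Type-free λ-terms over the variables `0, 1, 2, …`. -/
inductive LTerm : Type
  | var (x : ℕ) : LTerm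
  | app (P Q : LTerm) : LTerm
  | lam (x : ℕ) (P : LTerm) : LTerm

/-- The free variables of a term. -/
def LTerm.fv : LTerm → Finset ℕ
  | .var x => {x}
  | .app P Q => P.fv ∪ Q.fv
  | .lam x P => P.fv.erase x

/-- Simultaneous capture-avoiding substitution: the bound variable `x` of `λx.P` is renamed to a
fresh one exactly when it would capture a free variable of a term substituted into `λx.P`. -/
def LTerm.subst : LTerm → (ℕ → LTerm) → LTerm
  | .var x, τ => τ x
  | .app P Q, τ => .app (P.subst τ) (Q.subst τ)
  | .lam x P, τ =>
    let avoid : Finset ℕ := (P.fv.erase x).biUnion fun v => (τ v).fv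
    let z : ℕ := if x ∈ avoid then avoid.sup id + 1 else x
    .lam z (P.subst (Function.update τ x (.var z)))

/-- `[y/x]M`. -/
def LTerm.rename (y x : ℕ) (M : LTerm) : LTerm :=
  M.subst (Function.update LTerm.var x (.var y))

/-- `⟨D, •, ⟦ ⟧⟩` is a λ-model; `val M ρ` is `⟦M⟧_ρ` and `Function.update ρ x d` is `[d/x]ρ`. -/
structure IsLambdaModel {D : Type u} (op : D → D → D) (val : LTerm → (ℕ → D) → D) : Prop where
  nontrivial : ∃ a b : D, a ≠ b
  val_var : ∀ x ρ, val (.var x) ρ = ρ x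
  val_app : ∀ P Q ρ, val (.app P Q) ρ = op (val P ρ) (val Q ρ)
  val_lam : ∀ x P ρ d, op (val (.lam x P) ρ) d = val P (Function.update ρ x d)
  val_congr : ∀ M ρ τ, (∀ x ∈ M.fv, ρ x = τ x) → val M ρ = val M τ
  val_rename : ∀ x y M ρ, y ∉ M.fv → val (.lam x M) ρ = val (.lam y (M.rename y x)) ρ
  val_ext : ∀ x P Q ρ, (∀ d, val P (Function.update ρ x d) = val Q (Function.update ρ x d)) →
    val (.lam x P) ρ = val (.lam x Q) ρ

/-- `⟨D, •⟩` is an extensional λ-model: it underlies a λ-model, and elements that agree as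
functions are equal. -/
def IsExtensionalLambdaModel {D : Type u} (op : D → D → D) : Prop :=
  (∃ val : LTerm → (ℕ → D) → D, IsLambdaModel op val) ∧
    ∀ a b : D, (∀ d, op a d = op b d) → a = b

end ScottModel

end

noncomputable section

namespace ScottModel

/-! ## The projection pairs -/

/-! The passage to `𝔇_∞` uses nothing about homotopy. A cell `π_n(X, x)` determines `x`
(`piCell_injective`) and the source condition forces all components of a sequence to have the same
base point (`GlobSeq.base_eq`), so `x ↦ ⟨π_n(X, x)⟩` is bijective for every space. Application of
cells is defined through base points, hence the map is a homomorphism and the model structure is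
transported along it.

The substance is Scott's theorem that `D_∞` is an extensional λ-model. Each `φ_n` is left adjoint to
`ψ_n` with `ψ_n ∘ φ_n = id`; in the limit `φ_{n,∞}` is left adjoint to the `n`-th coordinate, and
every `a` is the supremum of the increasing chain `φ_{n,∞}(a_n)`. Two facts then identify `D_∞` with
its Scott-continuous self-maps: `a_{n+1}(x)` is the `n`-th coordinate of `a • φ_{n,∞}(x)`
(`DInf.app_phiInf_coord`), so `a` is determined by its action; and every Scott-continuous `f` is the
action of some element (`DInf.ofScott_app`). Abstraction is interpreted by that element, which is
legitimate because interpretations are Scott-continuous in each variable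
(`DInf.scottContinuous_val`). -/

theorem Stage.le_iff {n : ℕ} {f g : Stage (n + 1)} :
    f ≤ g ↔ ∀ x, f.toMap.toFun x ≤ g.toMap.toFun x := Iff.rfl

theorem phi_succ_apply (n : ℕ) (d : Stage (n + 1)) (x : Stage (n + 1)) :
    (phi (n + 1) d).toMap.toFun x = phi n (d.toMap.toFun (psi n x)) := rfl

theorem psi_succ_apply (n : ℕ) (g : Stage (n + 2)) (x : Stage n) :
    (psi (n + 1) g).toMap.toFun x = psi n (g.toMap.toFun (phi n x)) := rfl

theorem phi_monotone (n : ℕ) : Monotone (phi n) := (projPair n).1.scott.monotone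

theorem psi_monotone (n : ℕ) : Monotone (psi n) := (projPair n).2.scott.monotone

theorem Stage.toMap_monotone {n : ℕ} (f : Stage (n + 1)) : Monotone f.toMap.toFun :=
  f.toMap.scott.monotone

/-- At stage 0, `g(⊥)` is the least value of `g`. At a successor stage `g` is sandwiched between two
copies of `φ_n ∘ ψ_n`, each below the identity by induction. -/
theorem phi_psi_le : ∀ (n : ℕ) (g : Stage (n + 1)), phi n (psi n g) ≤ g
  | 0, g => Stage.le_iff.2 fun x => g.toMap_monotone (bot_le : (⊥ : Stage 0) ≤ x)
  | n + 1, g => Stage.le_iff.2 fun x => by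
      rw [phi_succ_apply, psi_succ_apply]
      exact (phi_psi_le n _).trans (g.toMap_monotone (phi_psi_le n x))

theorem gc_phi_psi (n : ℕ) : GaloisConnection (phi n) (psi n) := fun x y =>
  ⟨fun h => (psi_phi n x).ge.trans (psi_monotone n h),
    fun h => (phi_monotone n h).trans (phi_psi_le n y)⟩

theorem phiTo_self (n : ℕ) (x : Stage n) : phiTo n n x = x := by
  rw [phiTo, dif_pos le_rfl, Nat.leRecOn_self]

theorem phiTo_succ_of_le {n m : ℕ} (h : n ≤ m) (x : Stage n) :
    phiTo n (m + 1) x = phi m (phiTo n m x) := by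
  rw [phiTo, dif_pos (h.trans m.le_succ), Nat.leRecOn_succ h, phiTo, dif_pos h]

/-! ## The order of `D_∞` -/

/-- Lower coordinates are images of higher ones under the monotone maps `ψ_m`, so any tail
determines the order. -/
theorem DInf.le_of_coord_le_of_ge {a b : DInf} (n : ℕ)
    (h : ∀ m, n ≤ m → a.coord m ≤ b.coord m) : a ≤ b := by
  have down : ∀ k m, m + k ≥ n → a.coord m ≤ b.coord m := by
    intro k
    induction k with
    | zero => exact fun m hm => h m hm
    | succ k ih =>
      intro m hm
      rw [← a.compat, ← b.compat]
      exact psi_monotone m (ih (m + 1) (by omega))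
  exact fun m => down n m (by omega)

theorem phiInf_coord_self (n : ℕ) (x : Stage n) : (phiInf n x).coord n = x := phiTo_self n x

theorem phiInf_coord_succ {n m : ℕ} (h : n ≤ m) (x : Stage n) :
    (phiInf n x).coord (m + 1) = phi m ((phiInf n x).coord m) := phiTo_succ_of_le h x

/-- From `n` on, the coordinates of `φ_{n,∞}(x)` are iterated `φ`-images of `x`, so the adjunctions
`φ_m ⊣ ψ_m` chain together; the coordinates below `n` need no check. -/
theorem gc_phiInf_coord (n : ℕ) : GaloisConnection (phiInf n) (fun a : DInf => a.coord n) := by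
  intro x a
  refine ⟨fun h => (phiInf_coord_self n x).ge.trans (h n), fun h => ?_⟩
  refine DInf.le_of_coord_le_of_ge n fun m hm => ?_
  induction m, hm using Nat.le_induction with
  | base => rwa [phiInf_coord_self]
  | succ m hm ih =>
    rw [phiInf_coord_succ hm]
    refine (gc_phi_psi m).l_le ?_
    rwa [a.compat]

/-- Both sides have the same upper bounds by adjointness, which avoids the case distinction in
`phiTo`. -/
theorem phiInf_succ_phi (n : ℕ) (x : Stage n) : phiInf (n + 1) (phi n x) = phiInf n x := by
  refine eq_of_forall_ge_iff fun t => ?_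
  rw [gc_phiInf_coord (n + 1) (phi n x) t, gc_phiInf_coord n x t, gc_phi_psi, t.compat]

theorem phiInf_monotone (n : ℕ) : Monotone (phiInf n) := (gc_phiInf_coord n).monotone_l

theorem phiInf_coord_le (n : ℕ) (a : DInf) : phiInf n (a.coord n) ≤ a :=
  (gc_phiInf_coord n).l_u_le a

theorem phiInf_coord_monotone (a : DInf) : Monotone fun n => phiInf n (a.coord n) :=
  monotone_nat_of_le_succ fun n => by
    rw [← phiInf_succ_phi]
    refine phiInf_monotone _ ((gc_phi_psi n).l_le ?_)
    rw [a.compat]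

theorem isLUB_phiInf_coord (a : DInf) : IsLUB (range fun n => phiInf n (a.coord n)) a := by
  refine ⟨?_, fun t ht n => ?_⟩
  · rintro _ ⟨n, rfl⟩
    exact phiInf_coord_le n a
  · exact (gc_phiInf_coord n _ t).1 (ht ⟨n, rfl⟩)

/-! ## Scott-continuous functions -/

/-- A pointwise least upper bound of Scott-continuous functions is Scott-continuous. -/
theorem scottContinuous_of_isLUB {α β ι : Type*} [Preorder α] [Preorder β]
    {f : ι → α → β} {g : α → β} (hf : ∀ i, ScottContinuous (f i))
    (h : ∀ x, IsLUB (range fun i => f i x) (g x)) : ScottContinuous g := by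
  intro X hX hXd a ha
  constructor
  · rintro _ ⟨x, hx, rfl⟩
    refine (h x).2 ?_
    rintro _ ⟨i, rfl⟩
    exact ((hf i).monotone (ha.1 hx)).trans ((h a).1 ⟨i, rfl⟩)
  · intro t ht
    refine (h a).2 ?_
    rintro _ ⟨i, rfl⟩
    refine (hf i hX hXd ha).2 ?_
    rintro _ ⟨x, hx, rfl⟩
    exact ((h x).1 ⟨i, rfl⟩).trans (ht ⟨x, hx, rfl⟩)

/-- Separate Scott-continuity of a binary operation is enough for composition. -/
theorem scottContinuous_binary {α β γ δ : Type*} [Preorder α] [Preorder β] [Preorder γ]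
    [Preorder δ] {op : β → γ → δ} (h₁ : ∀ c, ScottContinuous fun b => op b c)
    (h₂ : ∀ b, ScottContinuous (op b)) {f : α → β} {g : α → γ} (hf : ScottContinuous f)
    (hg : ScottContinuous g) : ScottContinuous fun x => op (f x) (g x) := by
  intro X hX hXd a ha
  constructor
  · rintro _ ⟨x, hx, rfl⟩
    exact ((h₁ _).monotone (hf.monotone (ha.1 hx))).trans
      ((h₂ _).monotone (hg.monotone (ha.1 hx)))
  · intro t ht
    refine (((hf.comp (h₁ (g a))) hX hXd ha)).2 ?_
    rintro _ ⟨x, hx, rfl⟩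
    refine ((hg.comp (h₂ (f x))) hX hXd ha).2 ?_
    rintro _ ⟨y, hy, rfl⟩
    -- Directedness merges the two independent indices into one.
    obtain ⟨z, hz, hxz, hyz⟩ := hXd x hx y hy
    exact (((h₁ _).monotone (hf.monotone hxz)).trans ((h₂ _).monotone (hg.monotone hyz))).trans
      (ht ⟨z, hz, rfl⟩)

/-- Continuity of `ψ_n` makes the coordinatewise supremum an element of `D_∞`; uniqueness of least
upper bounds identifies it with the given one. -/
theorem scottContinuous_coord (n : ℕ) : ScottContinuous fun a : DInf => a.coord n := by
  intro X hX hXd a ha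
  have hdir : ∀ n, DirectedOn (· ≤ ·) ((fun d : DInf => d.coord n) '' X) := fun n =>
    hXd.mono_comp (rb := (· ≤ ·)) fun _ _ h => h n
  have hl := fun n => (hdir n).isLUB_sSup
  let s : DInf := ⟨fun n => sSup ((fun d : DInf => d.coord n) '' X), fun n => by
    have h := psi_scottContinuous n (hX.image _) (hdir (n + 1)) (hl (n + 1))
    rw [Set.image_image] at h
    refine h.unique ?_
    simp only [DInf.compat]
    exact hl n⟩
  have hs : IsLUB X s := by
    refine ⟨fun d hd n => (hl n).1 ⟨d, hd, rfl⟩, fun t ht n => (hl n).2 ?_⟩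
    rintro _ ⟨d, hd, rfl⟩
    exact ht hd n
  rw [ha.unique hs]
  exact hl n

theorem scottContinuous_phiInf (n : ℕ) : ScottContinuous (phiInf n) :=
  fun _ _ _ _ ha => (gc_phiInf_coord n).isLUB_l_image ha

theorem Stage.scottContinuous_eval {n : ℕ} (x : Stage n) :
    ScottContinuous fun f : Stage (n + 1) => f.toMap.toFun x :=
  fun _ _ hXd _ ha => ScottMap.isLUB_eval (D := Stage n) (E := Stage n) hXd ha x

/-! ## Application in `D_∞` -/

theorem DInf.psi_coord_apply_phi (a : DInf) (n : ℕ) (x : Stage n) :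
    psi n ((a.coord (n + 2)).toMap.toFun (phi n x)) = (a.coord (n + 1)).toMap.toFun x := by
  rw [← psi_succ_apply, a.compat]

theorem DInf.app_approx_monotone (a b : DInf) :
    Monotone fun n => phiInf n ((a.coord (n + 1)).toMap.toFun (b.coord n)) :=
  monotone_nat_of_le_succ fun n => by
    rw [← phiInf_succ_phi, ← a.psi_coord_apply_phi]
    refine phiInf_monotone _ ((phi_psi_le n _).trans (Stage.toMap_monotone _ ?_))
    refine (gc_phi_psi n).l_le ?_
    rw [b.compat]

theorem DInf.isLUB_app (a b : DInf) :
    IsLUB (range fun n => phiInf n ((a.coord (n + 1)).toMap.toFun (b.coord n))) (a.app b) :=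
  DirectedOn.isLUB_sSup (directedOn_range.2 (a.app_approx_monotone b).directed_le)

theorem DInf.scottContinuous_app_left (b : DInf) : ScottContinuous fun a : DInf => a.app b :=
  scottContinuous_of_isLUB
    (fun n => ((scottContinuous_coord (n + 1)).comp
      (Stage.scottContinuous_eval (b.coord n))).comp (scottContinuous_phiInf n))
    fun a => a.isLUB_app b

theorem DInf.scottContinuous_app_right (a : DInf) : ScottContinuous a.app :=
  scottContinuous_of_isLUB
    (fun n => ((scottContinuous_coord n).comp
      (a.coord (n + 1)).toMap.scott).comp (scottContinuous_phiInf n))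
    fun b => a.isLUB_app b

theorem DInf.phiInf_coord_apply_phiInf {n m : ℕ} (h : n ≤ m) (a : DInf) (x : Stage n) :
    (phiInf m ((a.coord (m + 1)).toMap.toFun ((phiInf n x).coord m))).coord n
      = (a.coord (n + 1)).toMap.toFun x := by
  induction m, h using Nat.le_induction with
  | base => rw [phiInf_coord_self, phiInf_coord_self]
  | succ m hm ih =>
    rw [phiInf_coord_succ hm, ← ih, ← a.psi_coord_apply_phi m]
    generalize (a.coord (m + 2)).toMap.toFun (phi m ((phiInf n x).coord m)) = y
    -- Up to coordinate `m`, embedding `y` from stage `m + 1` or `ψ_m(y)` from stage `m` makes no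
    -- difference.
    have key : ∀ k, k ≤ m → (phiInf (m + 1) y).coord k = (phiInf m (psi m y)).coord k := by
      intro k hk
      induction hk using Nat.decreasingInduction with
      | of_succ k hk ih => rw [← DInf.compat, ih, DInf.compat]
      | self => rw [← DInf.compat, phiInf_coord_self, phiInf_coord_self]
    exact key n hm

/-- The approximants to `a • φ_{n,∞}(x)` increase, and from index `n` on their `n`-th coordinate is
constant. -/
theorem DInf.app_phiInf_coord (a : DInf) (n : ℕ) (x : Stage n) :
    (a.app (phiInf n x)).coord n = (a.coord (n + 1)).toMap.toFun x := by
  have hd := (a.app_approx_monotone (phiInf n x)).directed_le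
  refine (scottContinuous_coord n (range_nonempty _) (directedOn_range.2 hd)
    (a.isLUB_app (phiInf n x))).unique ⟨?_, fun t ht => ?_⟩
  · rintro _ ⟨_, ⟨m, rfl⟩, rfl⟩
    refine (a.app_approx_monotone (phiInf n x) (le_max_right n m) n).trans_eq ?_
    exact a.phiInf_coord_apply_phiInf (le_max_left n m) x
  · refine ht ⟨_, ⟨n, rfl⟩, ?_⟩
    exact a.phiInf_coord_apply_phiInf le_rfl x

theorem DInf.le_of_app_le {a b : DInf} (h : ∀ d, a.app d ≤ b.app d) : a ≤ b := by
  -- Coordinate 0 is not a function, so the comparison starts at 1.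
  refine DInf.le_of_coord_le_of_ge 1 fun m hm => ?_
  obtain ⟨n, rfl⟩ := Nat.exists_eq_add_of_le' hm
  refine Stage.le_iff.2 fun x => ?_
  rw [← DInf.app_phiInf_coord, ← DInf.app_phiInf_coord]
  exact h _ n

theorem DInf.app_ext {a b : DInf} (h : ∀ d, a.app d = b.app d) : a = b :=
  (DInf.le_of_app_le fun d => (h d).le).antisymm (DInf.le_of_app_le fun d => (h d).ge)

/-! ## Representation of Scott-continuous functions -/

/-- The function `x ↦ f(φ_{n,∞}(x))_n`, an element of `D_{n+1}`. -/
def restrictStage {f : DInf → DInf} (hf : ScottContinuous f) (n : ℕ) : Stage (n + 1) :=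
  (⟨fun x => (f (phiInf n x)).coord n,
    ((scottContinuous_phiInf n).comp hf).comp (scottContinuous_coord n)⟩ :
    ScottMap (Stage n) (Stage n))

theorem psi_restrictStage {f : DInf → DInf} (hf : ScottContinuous f) (n : ℕ) :
    psi (n + 1) (restrictStage hf (n + 1)) = restrictStage hf n :=
  ScottMap.ext (funext fun (x : Stage n) => by
    change psi n ((f (phiInf (n + 1) (phi n x))).coord (n + 1)) = (f (phiInf n x)).coord n
    rw [DInf.compat, phiInf_succ_phi])

/-- The element of `D_∞` representing a Scott-continuous function. -/
def DInf.ofScott {f : DInf → DInf} (hf : ScottContinuous f) : DInf where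
  coord
    -- Compatibility forces this value.
    | 0 => psi 0 (restrictStage hf 0)
    | n + 1 => restrictStage hf n
  compat
    | 0 => rfl
    | n + 1 => psi_restrictStage hf n

theorem DInf.ofScott_app {f : DInf → DInf} (hf : ScottContinuous f) (b : DInf) :
    (DInf.ofScott hf).app b = f b := by
  refine ((DInf.ofScott hf).isLUB_app b).unique ⟨?_, fun t ht => ?_⟩
  · rintro _ ⟨n, rfl⟩
    exact (phiInf_coord_le n _).trans (hf.monotone (phiInf_coord_le n b))
  · refine (hf (range_nonempty _) (directedOn_range.2 (phiInf_coord_monotone b).directed_le)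
      (isLUB_phiInf_coord b)).2 ?_
    rintro _ ⟨_, ⟨m, rfl⟩, rfl⟩
    refine (isLUB_phiInf_coord _).2 ?_
    rintro _ ⟨k, rfl⟩
    -- The double supremum over `k` (coordinates of the value) and `m` (approximations of `b`) is
    -- bounded by its diagonal.
    refine le_trans ?_ (ht ⟨max k m, rfl⟩)
    refine (phiInf_coord_monotone _ (le_max_left k m)).trans (phiInf_monotone _ ?_)
    exact hf.monotone (phiInf_coord_monotone b (le_max_right k m)) _

open Classical in
/-- Abstraction: the representing element of a Scott-continuous function (`⊥` otherwise). -/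
def DInf.abs (f : DInf → DInf) : DInf :=
  if hf : ScottContinuous f then DInf.ofScott hf else ⊥

theorem DInf.abs_app {f : DInf → DInf} (hf : ScottContinuous f) (b : DInf) :
    (DInf.abs f).app b = f b := by
  rw [DInf.abs, dif_pos hf, DInf.ofScott_app]

/-! ## The interpretation of λ-terms in `D_∞` -/

/-- The interpretation `⟦M⟧_ρ` in `D_∞`. -/
def DInf.val : LTerm → (ℕ → DInf) → DInf
  | .var x, ρ => ρ x
  | .app P Q, ρ => (DInf.val P ρ).app (DInf.val Q ρ)
  | .lam x P, ρ => DInf.abs fun d => DInf.val P (Function.update ρ x d)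

theorem DInf.scottContinuous_val (M : LTerm) (ρ : ℕ → DInf) (x : ℕ) :
    ScottContinuous fun d => DInf.val M (Function.update ρ x d) := by
  induction M generalizing ρ x with
  | var y =>
    by_cases h : y = x
    · subst h
      simp [DInf.val, ScottContinuous]
    · simp only [DInf.val, Function.update_of_ne h]
      exact ScottContinuous.const (ρ y)
  | app P Q ihP ihQ =>
    exact scottContinuous_binary DInf.scottContinuous_app_left DInf.scottContinuous_app_right
      (ihP ρ x) (ihQ ρ x)
  | lam y P ih =>
    by_cases h : y = x
    · subst h
      simp only [DInf.val, Function.update_idem]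
      exact ScottContinuous.const _
    -- Continuity of `DInf.abs` itself is never needed: `DInf.le_of_app_le` reduces each inequality
    -- to one after application to an arbitrary `e`, where the induction hypothesis for the body
    -- applies.
    · have comm : ∀ d e : DInf, Function.update (Function.update ρ x d) y e
          = Function.update (Function.update ρ y e) x d := fun d e => (Function.update_comm h e d ρ).symm
      have app_eq : ∀ d e, (DInf.val (.lam y P) (Function.update ρ x d)).app e
          = DInf.val P (Function.update (Function.update ρ y e) x d) := fun d e => by
        rw [DInf.val, DInf.abs_app (ih _ y), comm]
      intro X hX hXd a ha
      have hlub := fun e => ih (Function.update ρ y e) x hX hXd ha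
      constructor
      · rintro _ ⟨d, hd, rfl⟩
        refine DInf.le_of_app_le fun e => ?_
        rw [app_eq, app_eq]
        exact (hlub e).1 ⟨d, hd, rfl⟩
      · intro t ht
        refine DInf.le_of_app_le fun e => ?_
        rw [app_eq]
        refine (hlub e).2 ?_
        rintro _ ⟨d, hd, rfl⟩
        change DInf.val P (Function.update (Function.update ρ y e) x d) ≤ _
        rw [← app_eq]
        exact (DInf.scottContinuous_app_left e).monotone (ht ⟨d, hd, rfl⟩)

theorem DInf.val_congr (M : LTerm) {ρ τ : ℕ → DInf} (h : ∀ x ∈ M.fv, ρ x = τ x) :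
    DInf.val M ρ = DInf.val M τ := by
  induction M generalizing ρ τ with
  | var x => exact h x (by simp [LTerm.fv])
  | app P Q ihP ihQ =>
    rw [DInf.val, DInf.val, ihP fun x hx => h x (by simp [LTerm.fv, hx]),
      ihQ fun x hx => h x (by simp [LTerm.fv, hx])]
  | lam x P ih =>
    refine congrArg DInf.abs (funext fun d => ih fun y hy => ?_)
    by_cases hyx : y = x
    · simp [hyx]
    · simpa [hyx] using h y (by simp [LTerm.fv, hy, hyx])

theorem LTerm.notMem_ite_fresh (s : Finset ℕ) (x : ℕ) :
    (if x ∈ s then s.sup id + 1 else x) ∉ s := by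
  split_ifs with h
  · intro hs
    exact absurd (Finset.le_sup (f := id) hs) (Nat.not_succ_le_self _)
  · exact h

theorem DInf.val_subst (M : LTerm) (τ : ℕ → LTerm) (ρ : ℕ → DInf) :
    DInf.val (M.subst τ) ρ = DInf.val M fun x => DInf.val (τ x) ρ := by
  induction M generalizing τ ρ with
  | var x => rfl
  | app P Q ihP ihQ => rw [LTerm.subst, DInf.val, DInf.val, ihP, ihQ]
  | lam x P ih =>
    have hz := LTerm.notMem_ite_fresh ((P.fv.erase x).biUnion fun v => (τ v).fv) x
    simp only [LTerm.subst]
    -- Only the freshness `hz` of the new bound variable matters: updating it leaves the values of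
    -- the substituted terms unchanged.
    generalize (if x ∈ (P.fv.erase x).biUnion fun v => (τ v).fv then
      ((P.fv.erase x).biUnion fun v => (τ v).fv).sup id + 1 else x) = z at hz ⊢
    refine congrArg DInf.abs (funext fun d => ?_)
    rw [ih]
    refine DInf.val_congr P fun v hv => ?_
    by_cases hvx : v = x
    · simp [hvx, DInf.val]
    · simp only [Function.update_of_ne hvx]
      refine DInf.val_congr _ fun w hw => Function.update_of_ne ?_ _ _
      rintro rfl
      exact hz (Finset.mem_biUnion.2 ⟨v, Finset.mem_erase.2 ⟨hvx, hv⟩, hw⟩)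

theorem DInf.val_lam_rename {x y : ℕ} {M : LTerm} (hy : y ∉ M.fv) (ρ : ℕ → DInf) :
    DInf.val (.lam x M) ρ = DInf.val (.lam y (M.rename y x)) ρ := by
  refine congrArg DInf.abs (funext fun d => ?_)
  rw [LTerm.rename, DInf.val_subst]
  refine DInf.val_congr M fun v hv => ?_
  by_cases hvx : v = x
  · simp [hvx, DInf.val]
  · have hvy : v ≠ y := fun h => hy (h ▸ hv)
    simp [hvx, hvy, DInf.val]

theorem DInf.exists_ne : ∃ a b : DInf, a ≠ b := by
  -- `⊥` and `0` in `ℕ⁺` remain distinct because coordinate 0 recovers them.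
  refine ⟨phiInf 0 (none : Option ℕ), phiInf 0 (some 0 : Option ℕ), fun h => ?_⟩
  have h0 : (none : Option ℕ) = some 0 := (phiInf_coord_self 0 _).symm.trans
    ((congrArg (fun a : DInf => a.coord 0) h).trans (phiInf_coord_self 0 _))
  exact Option.some_ne_none 0 h0.symm

theorem DInf.isExtensionalLambdaModel : IsExtensionalLambdaModel DInf.app :=
  ⟨⟨DInf.val,
    { nontrivial := DInf.exists_ne
      val_var := fun _ _ => rfl
      val_app := fun _ _ _ => rfl
      val_lam := fun x P ρ => DInf.abs_app (DInf.scottContinuous_val P ρ x)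
      val_congr := fun M _ _ h => DInf.val_congr M h
      val_rename := fun _ _ _ ρ hy => DInf.val_lam_rename hy ρ
      val_ext := fun _ _ _ _ h => congrArg DInf.abs (funext h) }⟩,
    fun _ _ => DInf.app_ext⟩

/-! ## Transport to `𝔇_∞` -/

theorem IsExtensionalLambdaModel.of_equiv {D : Type u} {E : Type v} {op : D → D → D}
    {op' : E → E → E} (e : D ≃ E) (he : ∀ a b, e (op a b) = op' (e a) (e b))
    (h : IsExtensionalLambdaModel op) : IsExtensionalLambdaModel op' := by
  obtain ⟨⟨val, hv⟩, hext⟩ := h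
  have hupd : ∀ (ρ : ℕ → E) x d,
      e.symm ∘ Function.update ρ x d = Function.update (e.symm ∘ ρ) x (e.symm d) :=
    fun ρ x d => Function.comp_update _ _ _ _
  -- Terms are evaluated in `E` by pulling the assignment back to `D` and pushing the value forward.
  refine ⟨⟨fun M ρ => e (val M (e.symm ∘ ρ)), ?_⟩, fun a b hab => ?_⟩
  · constructor
    · obtain ⟨a, b, hab⟩ := hv.nontrivial
      exact ⟨e a, e b, e.injective.ne hab⟩
    · intro x ρ
      simp [hv.val_var]
    · intro P Q ρ
      rw [hv.val_app, he]
    · intro x P ρ d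
      rw [hupd, ← hv.val_lam, he, e.apply_symm_apply]
    · intro M ρ τ h
      exact congrArg e (hv.val_congr M _ _ fun x hx => congrArg e.symm (h x hx))
    · intro x y M ρ hy
      rw [hv.val_rename x y M _ hy]
    · intro x P Q ρ h
      refine congrArg e (hv.val_ext x P Q _ fun d => ?_)
      have hd := e.injective (h (e d))
      simpa only [hupd, e.symm_apply_apply] using hd
  · refine e.symm.injective (hext _ _ fun d => e.injective ?_)
    rw [he, he, e.apply_symm_apply, e.apply_symm_apply]
    exact hab _

theorem GlobSeq.base_eq {X : Type u} [TopologicalSpace X] (c : GlobSeq X) (n : ℕ) :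
    (c.1 n).base = (c.1 0).base := by
  induction n with
  | zero => rfl
  | succ n ih => rw [← ih, ← (c.2 n).1, Glob.src, Glob.base_pi]

/-- The bijection `x ↦ ⟨π_n(X, x)⟩_n` from `X` onto the set of its cell sequences. -/
def GlobSeq.equiv (X : Type u) [TopologicalSpace X] : X ≃ GlobSeq X where
  toFun x := ⟨fun n => Glob.pi n x, fun n => by
    simp only [Glob.src, Glob.tgt, Glob.base_pi, and_self]⟩
  invFun c := (c.1 0).base
  left_inv x := Glob.base_pi 0 x
  right_inv c := Subtype.ext (funext fun n => by
    change Glob.pi n (c.1 0).base = c.1 n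
    rw [← c.base_eq n, Glob.pi_base])

theorem GlobSeq.equiv_app (a b : DInf) :
    GlobSeq.equiv DInf (a.app b) = (GlobSeq.equiv DInf a).app (GlobSeq.equiv DInf b) :=
  Subtype.ext (funext fun n => (Glob.app_pi n a b).symm)

end ScottModel

end

theorem theorem5p1 :
    (∃ F : ScottModel.DInf ≃ ScottModel.GlobSeq ScottModel.DInf,
      (∀ (a : ScottModel.DInf) (n : ℕ),
        ((F a).1 n).1 = (ScottModel.piCell n a : ScottModel.CellType ScottModel.DInf n)) ∧
      ∀ a b : ScottModel.DInf,
        F (ScottModel.DInf.app a b) = ScottModel.GlobSeq.app (F a) (F b)) ∧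
    ScottModel.IsExtensionalLambdaModel ScottModel.GlobSeq.app :=
  ⟨⟨ScottModel.GlobSeq.equiv ScottModel.DInf, fun _ _ => rfl, ScottModel.GlobSeq.equiv_app⟩,
    ScottModel.DInf.isExtensionalLambdaModel.of_equiv (ScottModel.GlobSeq.equiv ScottModel.DInf)
      ScottModel.GlobSeq.equiv_app⟩
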